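/- For a real number $x$ let $q(x)$ denote the smallest prime number $p$ with $p \ge x$. For an integer $k$, call a graph $H$ \emph{$k$-divisible} if $d_H(u) \equiv 0 \pmod{k}$ for every vertex $u$ of $H$, and call a graph non-empty if it has at least one edge. Lemma. Let $k \ge 2$ be an integer, and let $G$ be a finite simple graph with $n$ vertices and $e(G)$ edges. If $G$ contains no non-empty $k$-divisible subgraph, then $e(G) \le \bigl(q(\tfrac{3k}{2}) - 1\bigr) n$. Moreover, if $k$ is odd, then $e(G) \le (q(k) - 1) n$. -/

import Mathlib

/-- `leastPrimeGE x` is the smallest prime number `p` with `p ≥ x`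
(the set below is non-empty, as there are infinitely many primes). -/
noncomputable def leastPrimeGE (x : ℝ) : ℕ :=
  sInf {p : ℕ | p.Prime ∧ x ≤ (p : ℝ)}

/-- The infimum in `leastPrimeGE` is attained. -/
theorem leastPrimeGE_spec (x : ℝ) :
    (leastPrimeGE x).Prime ∧ x ≤ (leastPrimeGE x : ℝ) := by
  have h : {p : ℕ | p.Prime ∧ x ≤ (p : ℝ)}.Nonempty := by
    obtain ⟨n, hn⟩ := exists_nat_ge x
    obtain ⟨p, hp, hpp⟩ := Nat.exists_infinite_primes n
    exact ⟨p, hpp, hn.trans (by exact_mod_cast hp)⟩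
  exact Nat.sInf_mem h

/-- A graph `H` is `k`-divisible if every vertex has degree congruent to `0` modulo `k`. -/
def IsKDivisible {W : Type*} (k : ℕ) (H : SimpleGraph W) [H.LocallyFinite] : Prop :=
  ∀ u : W, H.degree u ≡ 0 [MOD k]

open Classical in
/-- `G` contains a non-empty `k`-divisible subgraph: a (not necessarily induced or spanning)
subgraph with at least one edge that is `k`-divisible as a graph in its own right. -/
def HasNonemptyKDivisibleSubgraph {V : Type*} [Fintype V] (k : ℕ) (G : SimpleGraph V) : Prop :=
  ∃ H : G.Subgraph, H.edgeSet.Nonempty ∧ IsKDivisible k H.coe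

/-! Let `p` be an odd prime and suppose that `e(G) > (p - 1)n`. For each vertex take the polynomial
summing `X e ^ (p - 1)` over its incident edges. The degrees add up to less than the number of
variables, so Chevalley–Warning gives a nonzero common root over `ZMod p`. Its support is a
non-empty edge set with all degrees divisible by `p`. Splitting each vertex into copies of degree
`p` yields a `p`-regular multigraph. It is enough to find in it a non-empty edge set with all
degrees `0` or `k`, since merging the copies again gives a `k`-divisible subgraph.

Multigraphs are encoded by half-edges: `vtx` gives the endpoint and the fixed-point-free involution
`σ` the other half. A `k`-factor is a perfect matching of a gadget in which each vertex has `r = p -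
k` core vertices, which absorb the half-edges left out of the factor. Tutte's condition is checked
with weights of total `p` at every gadget vertex. An odd set sends out at least `p` unless it comes
from a bridge (`gadget_cut_bound`), which is where `3k ≤ 2p` (`k` even) or `p ≤ 3k` (`k` odd)
enters. By parity Tutte's condition tolerates two exceptional odd sets.

Bridges are removed by induction on the vertex set. For even `k` one passes to a piece with at most
one outgoing edge, and parity forbids using that edge. For odd `k` solutions on the two sides of a
bridge are glued, or one of them suffices alone. Descending `p, p - 2, ..., k` then removes the
restriction `p ≤ 3k`. -/

/-! ### Parity and a weighted form of Tutte's theorem -/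

open Finset in
theorem even_card_of_fixedPointFree_involution {α : Type*} (s : Finset α) (f : α → α)
    (hs : ∀ x ∈ s, f x ∈ s) (hf : ∀ x ∈ s, f (f x) = x) (hne : ∀ x ∈ s, f x ≠ x) :
    Even s.card := by
  have h : ∑ _x ∈ s, (1 : ZMod 2) = 0 :=
    Finset.sum_involution (fun x _ => f x) (fun _ _ => by decide)
      (fun x hx _ => hne x hx) hs hf
  rw [Finset.sum_const, nsmul_eq_mul, mul_one, ZMod.natCast_eq_zero_iff] at h
  exact even_iff_two_dvd.mpr h

open Classical Finset in
/-- A weighted sufficient condition for perfect matchings, derived from Tutte's theorem: every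
vertex has total weight `p`, and every odd set sends out weight at least `p`, except possibly
those containing one of two prescribed vertices, which send out weight at least `1`. -/
theorem exists_isPerfectMatching_of_weights {W : Type*} [Fintype W] (Γ : SimpleGraph W)
    (w : W → W → ℕ) (p : ℕ) (hp : 0 < p)
    (hsupp : ∀ x y, w x y ≠ 0 → Γ.Adj x y)
    (hsum : ∀ y, ∑ x, w x y ≤ p) (heven : Even (Fintype.card W)) (x₀ x₁ : W)
    (hcut : ∀ K : Finset W, Odd K.card →
      p ≤ (∑ x ∈ K, ∑ y ∈ Kᶜ, w x y) + (p - 1) * (if x₀ ∈ K then 1 else 0)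
        + (p - 1) * (if x₁ ∈ K then 1 else 0)) :
    ∃ M : Γ.Subgraph, M.IsPerfectMatching := by
  rw [SimpleGraph.tutte]
  intro U hU
  unfold SimpleGraph.IsTutteViolator at hU
  set S := (⊤ : Γ.Subgraph).deleteVerts U with hS
  have hverts : S.verts = Uᶜ := by
    ext x; simp [hS]
  have hadj : ∀ (x y : S.verts), Γ.Adj x y → S.coe.Adj x y := by
    rintro ⟨x, hx⟩ ⟨y, hy⟩ h
    have hx' := hx
    have hy' := hy
    rw [hverts] at hx' hy'
    simp only [hS, SimpleGraph.Subgraph.coe_adj, SimpleGraph.Subgraph.deleteVerts_adj]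
    exact ⟨trivial, hx', trivial, hy', h⟩
  let K : S.coe.ConnectedComponent → Finset W := fun c => (Subtype.val '' c.supp).toFinset
  have hKmem : ∀ c x, x ∈ K c ↔ ∃ hx : x ∈ S.verts, S.coe.connectedComponentMk ⟨x, hx⟩ = c := by
    intro c x
    simp [K]
  have hKcard : ∀ c, (K c).card = c.supp.ncard := by
    intro c
    rw [← Set.ncard_eq_toFinset_card', Set.ncard_image_of_injective _ Subtype.val_injective]
  let O : Finset S.coe.ConnectedComponent := S.coe.oddComponents.toFinset
  have hO : S.coe.oddComponents.ncard = O.card := Set.ncard_eq_toFinset_card' _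
  have hdisj : ∀ c ∈ O, ∀ c' ∈ O, c ≠ c' → Disjoint (K c) (K c') := by
    intro c _ c' _ hne
    rw [Finset.disjoint_left]
    intro x hx hx'
    obtain ⟨h1, h2⟩ := (hKmem _ _).1 hx
    obtain ⟨h3, h4⟩ := (hKmem _ _).1 hx'
    exact hne (h2.symm.trans h4)
  -- Weight lives on edges, and an edge leaving a component of the graph minus `U` must end in `U`.
  have hsubU : ∀ c, ∑ x ∈ K c, ∑ y ∈ (K c)ᶜ, w x y ≤ ∑ x ∈ K c, ∑ y ∈ U.toFinset, w x y := by
    intro c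
    refine Finset.sum_le_sum fun x hx => ?_
    refine Finset.sum_le_sum_of_ne_zero fun y hy hw => ?_
    rw [Set.mem_toFinset]
    by_contra hyU
    obtain ⟨h1, h2⟩ := (hKmem _ _).1 hx
    have hyv : y ∈ S.verts := by rw [hverts]; exact hyU
    refine (Finset.mem_compl.1 hy) ((hKmem _ _).2 ⟨hyv, ?_⟩)
    rw [← h2]
    exact SimpleGraph.ConnectedComponent.sound
      (SimpleGraph.Adj.reachable (hadj ⟨y, hyv⟩ ⟨x, h1⟩ (hsupp x y hw).symm))
  have htotal : ∑ c ∈ O, ∑ x ∈ K c, ∑ y ∈ (K c)ᶜ, w x y ≤ p * U.ncard := by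
    calc ∑ c ∈ O, ∑ x ∈ K c, ∑ y ∈ (K c)ᶜ, w x y
        ≤ ∑ c ∈ O, ∑ x ∈ K c, ∑ y ∈ U.toFinset, w x y := Finset.sum_le_sum fun c _ => hsubU c
      _ = ∑ x ∈ O.biUnion K, ∑ y ∈ U.toFinset, w x y := by
          rw [Finset.sum_biUnion]
          intro c hc c' hc' hne
          exact hdisj c hc c' hc' hne
      _ ≤ ∑ x, ∑ y ∈ U.toFinset, w x y :=
          Finset.sum_le_sum_of_subset (Finset.subset_univ _)
      _ = ∑ y ∈ U.toFinset, ∑ x, w x y := Finset.sum_comm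
      _ ≤ ∑ _y ∈ U.toFinset, p := Finset.sum_le_sum fun y _ => hsum y
      _ = p * U.ncard := by
          rw [Finset.sum_const, smul_eq_mul, mul_comm, Set.ncard_eq_toFinset_card']
  have hone : ∀ z : W, ∑ c ∈ O, (if z ∈ K c then 1 else 0) ≤ 1 := by
    intro z
    rw [← Finset.card_filter, Finset.card_le_one]
    intro c hc c' hc'
    rw [Finset.mem_filter] at hc hc'
    by_contra hne
    exact Finset.disjoint_left.1 (hdisj c hc.1 c' hc'.1 hne) hc.2 hc'.2
  have hlower : p * O.card ≤ (∑ c ∈ O, ∑ x ∈ K c, ∑ y ∈ (K c)ᶜ, w x y) + (p - 1) + (p - 1) := by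
    calc p * O.card = ∑ _c ∈ O, p := by rw [Finset.sum_const, smul_eq_mul, mul_comm]
      _ ≤ ∑ c ∈ O, ((∑ x ∈ K c, ∑ y ∈ (K c)ᶜ, w x y) + (p - 1) * (if x₀ ∈ K c then 1 else 0)
          + (p - 1) * (if x₁ ∈ K c then 1 else 0)) := by
          refine Finset.sum_le_sum fun c hc => hcut _ ?_
          rw [hKcard]
          have hc' : c ∈ S.coe.oddComponents := Set.mem_toFinset.1 hc
          exact hc'
      _ = (∑ c ∈ O, ∑ x ∈ K c, ∑ y ∈ (K c)ᶜ, w x y)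
          + (p - 1) * (∑ c ∈ O, if x₀ ∈ K c then 1 else 0)
          + (p - 1) * (∑ c ∈ O, if x₁ ∈ K c then 1 else 0) := by
          rw [Finset.sum_add_distrib, Finset.sum_add_distrib, Finset.mul_sum, Finset.mul_sum]
      _ ≤ _ := by
          have h0 := Nat.mul_le_mul_left (p - 1) (hone x₀)
          have h1 := Nat.mul_le_mul_left (p - 1) (hone x₁)
          omega
  have hparity : Odd O.card ↔ Odd U.ncard := by
    rw [← hO, SimpleGraph.odd_ncard_oddComponents, hverts, Nat.card_coe_set_eq]
    have := Set.ncard_add_ncard_compl U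
    rw [Nat.card_eq_fintype_card] at this
    rw [← this] at heven
    rw [Nat.even_add] at heven
    rw [← Nat.not_even_iff_odd, ← Nat.not_even_iff_odd, heven]
  rw [hO] at hU
  -- Parity gains one more odd component, so the two exemptions, worth `2(p - 1) < 2p` in total,
  -- cannot save a violator.
  have hge : U.ncard + 2 ≤ O.card := by
    have : O.card ≠ U.ncard + 1 := by
      intro h
      rw [h] at hparity
      rcases Nat.even_or_odd U.ncard with he | ho
      · exact absurd (hparity.1 he.add_one) (Nat.not_odd_iff_even.2 he)
      · exact absurd (hparity.2 ho) (Nat.not_odd_iff_even.2 ho.add_one)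
    omega
  have h2 := Nat.mul_le_mul_left p hge
  rw [Nat.mul_add] at h2
  omega

/-! ### The cut estimate -/

-- Modulo 2 the two halves of an edge cancel when `F` agrees on them. Only crossing edges survive,
-- each listed once by its half in `D`.
open Classical Finset in
theorem sum_eq_sum_crossing {H : Type*} [Fintype H] (σ : H → H) (hσ : ∀ h, σ (σ h) = h)
    (hfp : ∀ h, σ h ≠ h) (F : H → ZMod 2) (D : H → Prop) (hD : ∀ h, D h → ¬ D (σ h))
    (hF : ∀ h, ¬ D h → ¬ D (σ h) → F h = F (σ h)) :
    ∑ h, F h = ∑ h with D h, (F h + F (σ h)) := by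
  have h2 : ∀ a : ZMod 2, a + a = 0 := by decide
  have key : ∑ h, (F h + if D h then F h + F (σ h) else 0) = 0 := by
    refine Finset.sum_involution (fun h _ => σ h) ?_ (fun h _ _ => hfp h) (by simp)
      (fun h _ => hσ h)
    intro h _
    by_cases h1 : D h
    · have := hD h h1
      simp only [h1, this, if_true, if_false, hσ]
      linear_combination h2 (F h) + h2 (F (σ h))
    · by_cases h3 : D (σ h)
      · simp only [h1, h3, if_true, if_false, hσ]
        linear_combination h2 (F h) + h2 (F (σ h))
      · simp only [h1, h3, if_false]
        rw [hF h h1 h3]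
        linear_combination h2 (F (σ h))
  rw [Finset.sum_add_distrib, ← Finset.sum_filter] at key
  linear_combination key - h2 (∑ h with D h, (F h + F (σ h)))

theorem natCast_zmod_two_eq_one {n : ℕ} : (n : ZMod 2) = 1 ↔ Odd n := by
  rw [← Nat.cast_one, ZMod.natCast_eq_natCast_iff', Nat.odd_iff]

theorem add_le_sum_of_ne {H : Type*} [Fintype H] (f : H → ℕ) {a b : H} (hab : a ≠ b) :
    f a + f b ≤ ∑ h, f h := by
  classical
  rw [← Finset.sum_pair hab]
  exact Finset.sum_le_sum_of_subset (Finset.subset_univ _)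

open Classical Finset in
/-- The cut estimate in the factor gadget: `A` selects half-edges and `B` selects core vertices. -/
theorem gadget_cut_bound {V H : Type*} [Fintype V] [Fintype H] (vtx : H → V) (σ : H → H)
    (hσ : ∀ h, σ (σ h) = h) (hfp : ∀ h, σ h ≠ h) (p k r : ℕ) (hpodd : Odd p) (hkr : k + r = p)
    (hk0 : 0 < k) (hr0 : 0 < r)
    (hk : (Even k ∧ 3 * k ≤ 2 * p) ∨ (Odd k ∧ p ≤ 3 * k))
    (hfib : ∀ v, #{h | vtx h = v} = p) (v₀ v₁ : V)
    (hbridge : ∀ C : Set V, #{h | vtx h ∈ C ∧ vtx (σ h) ∉ C} = 1 → v₀ ∈ C ∨ v₁ ∈ C)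
    (A : H → Prop) (B : V → Fin r → Prop)
    (hodd : Odd (#{h | A h} + ∑ v, #{i | B v i})) :
    p ≤ (∑ h, ((if A h ∧ ¬ A (σ h) then k else 0) + #{i | ¬ (A h ↔ B (vtx h) i)}))
      + (p - 1) * (if B v₀ ⟨0, hr0⟩ then 1 else 0)
      + (p - 1) * (if B v₁ ⟨0, hr0⟩ then 1 else 0) := by
  set f : H → ℕ := fun h => (if A h ∧ ¬ A (σ h) then k else 0) + #{i | ¬ (A h ↔ B (vtx h) i)}
    with hf
  suffices hmain : p ≤ ∑ h, f h ∨ (1 ≤ ∑ h, f h ∧ (B v₀ ⟨0, hr0⟩ ∨ B v₁ ⟨0, hr0⟩)) by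
    change p ≤ (∑ h, f h) + _ + _
    rcases hmain with h | ⟨h, h' | h'⟩
    · exact h.trans (by rw [add_assoc]; exact Nat.le_add_right _ _)
    · rw [if_pos h']; omega
    · rw [if_pos h']; omega
  -- If the core of `v` is split, each of the `p` half-edges at `v` disagrees with some core vertex.
  by_cases hmix : ∃ v i j, B v i ∧ ¬ B v j
  · obtain ⟨v, i, j, hi, hj⟩ := hmix
    left
    calc p = ∑ h with vtx h = v, 1 := by rw [Finset.sum_const, hfib, smul_eq_mul, mul_one]
      _ ≤ ∑ h with vtx h = v, f h := by
          refine Finset.sum_le_sum fun h hh => ?_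
          rw [Finset.mem_filter] at hh
          refine le_trans ?_ (Nat.le_add_left _ _)
          rw [Nat.one_le_iff_ne_zero, Finset.card_ne_zero, hh.2]
          by_cases hA : A h
          · exact ⟨j, by simp [hA, hj]⟩
          · exact ⟨i, by simp [hA, hi]⟩
      _ ≤ _ := Finset.sum_le_sum_of_subset (Finset.subset_univ _)
  push Not at hmix
  obtain ⟨C, hBC⟩ : ∃ C : V → Prop, ∀ v i, B v i ↔ C v :=
    ⟨fun v => B v ⟨0, hr0⟩, fun v i => ⟨fun h => hmix v _ _ h, fun h => hmix v _ _ h⟩⟩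
  obtain ⟨flip, hflipdef⟩ : ∃ flip : H → Prop, ∀ h, flip h ↔ ¬ (A h ↔ C (vtx h)) :=
    ⟨_, fun _ => Iff.rfl⟩
  have hfr : ∀ h, f h = (if A h ∧ ¬ A (σ h) then k else 0) + if flip h then r else 0 := by
    intro h
    simp only [hf, hBC, ← hflipdef]
    congr 1
    by_cases hh : flip h
    · rw [if_pos hh, Finset.filter_true_of_mem (fun _ _ => hh)]
      simp
    · rw [if_neg hh, Finset.filter_false_of_mem (fun _ _ => hh)]
      simp
  by_cases hsame : ∃ h, flip h ∧ ¬ flip (σ h) ∧ (C (vtx h) ↔ C (vtx (σ h)))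
  · obtain ⟨h, h1, h2, h3⟩ := hsame
    left
    refine le_trans ?_ (add_le_sum_of_ne f (hfp h).symm)
    rw [hfr, hfr, if_pos h1, hσ]
    have : (A h ∧ ¬ A (σ h)) ∨ (A (σ h) ∧ ¬ A h) := by
      rw [hflipdef] at h1 h2
      tauto
    rcases this with h4 | h4
    · rw [if_pos h4]; omega
    · rw [if_pos h4]; omega
  obtain ⟨D, hDdef⟩ : ∃ D : H → Prop, ∀ h, D h ↔ C (vtx h) ∧ ¬ C (vtx (σ h)) :=
    ⟨_, fun _ => Iff.rfl⟩
  -- Both halves of a crossing edge flipped cost `r + r + k ≥ p`.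
  by_cases hboth : ∃ h, D h ∧ flip h ∧ flip (σ h)
  · obtain ⟨h, h1, h2, h3⟩ := hboth
    left
    refine le_trans ?_ (add_le_sum_of_ne f (hfp h).symm)
    rw [hfr, hfr, if_pos h2, if_pos h3, hσ]
    have : A (σ h) ∧ ¬ A h := by
      simp only [hflipdef, hDdef] at h1 h2 h3
      tauto
    rw [if_pos this]; omega
  push Not at hsame hboth
  have hDσ : ∀ h, D h → ¬ D (σ h) := fun h h1 h2 =>
    ((hDdef _).1 h2).2 (by rw [hσ]; exact ((hDdef _).1 h1).1)
  -- The remaining crossing edges are `b` with one flip, costing `r` or more each, and `a` with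
  -- none, costing `k` each.
  set b := #{h | D h ∧ (flip h ∨ flip (σ h))} with hb
  set a := #{h | D h ∧ ¬ (flip h ∨ flip (σ h))} with ha
  have hab : #{h | D h} = a + b := by
    rw [ha, hb, ← Finset.filter_filter, ← Finset.filter_filter, add_comm,
      Finset.card_filter_add_card_filter_not]
  have hcost : k * a + r * b ≤ ∑ h, f h := by
    have hdisj : Disjoint (univ.filter D) (univ.filter fun h => D (σ h)) := by
      rw [Finset.disjoint_filter]
      exact fun h _ h1 => hDσ h h1
    calc k * a + r * b = ∑ h with D h, (if flip h ∨ flip (σ h) then r else k) := by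
          rw [Finset.sum_ite, Finset.sum_const, Finset.sum_const, Finset.filter_filter,
            Finset.filter_filter, ← ha, ← hb, smul_eq_mul, smul_eq_mul]
          ring
      _ ≤ ∑ h with D h, (f h + f (σ h)) := by
          refine Finset.sum_le_sum fun h hh => ?_
          have hD : D h := (Finset.mem_filter.1 hh).2
          rw [hfr, hfr, hσ]
          by_cases h1 : flip h
          · rw [if_pos (Or.inl h1), if_pos h1]; omega
          by_cases h2 : flip (σ h)
          · rw [if_pos (Or.inr h2), if_pos h2]; omega
          have : A h ∧ ¬ A (σ h) := by
            simp only [hflipdef, hDdef] at h1 h2 hD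
            tauto
          rw [if_neg (by tauto), if_pos this]; omega
      _ = ∑ h with D h, f h + ∑ h with D (σ h), f h := by
          rw [Finset.sum_add_distrib]
          congr 1
          refine Finset.sum_bij' (fun h _ => σ h) (fun h _ => σ h) ?_ ?_ ?_ ?_ ?_ <;>
            simp [hσ]
      _ = ∑ h ∈ univ.filter D ∪ univ.filter (fun h => D (σ h)), f h :=
          (Finset.sum_union hdisj).symm
      _ ≤ _ := Finset.sum_le_sum_of_subset (Finset.subset_univ _)
  -- parity
  let ind : Prop → ZMod 2 := fun P => if P then 1 else 0
  have hcount : ∀ P : H → Prop, ((#{h | P h} : ℕ) : ZMod 2) = ∑ h, ind (P h) := by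
    intro P
    simp [ind]
  have hp1 : (p : ZMod 2) = 1 := natCast_zmod_two_eq_one.2 hpodd
  have hCsum : ∑ h, ind (C (vtx h)) = ((#{v | C v} : ℕ) : ZMod 2) := by
    rw [← hcount, Finset.card_eq_sum_card_fiberwise (f := vtx) (t := univ.filter C)]
    · have : ∀ v ∈ univ.filter C, #{h ∈ univ.filter (fun h => C (vtx h)) | vtx h = v} = p := by
        intro v hv
        rw [← hfib v, Finset.filter_filter]
        congr 1
        ext h
        simp only [Finset.mem_filter, Finset.mem_univ, true_and] at hv ⊢
        constructor
        · exact fun h => h.2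
        · rintro rfl; exact ⟨hv, rfl⟩
      rw [Finset.sum_congr rfl this, Finset.sum_const, smul_eq_mul, Nat.cast_mul, hp1, mul_one]
    · intro h hh
      simpa using hh
  have hCsum' : ∑ h, ind (C (vtx h)) = (a : ZMod 2) + b := by
    rw [sum_eq_sum_crossing σ hσ hfp _ D hDσ]
    · rw [← Nat.cast_add, ← hab, Finset.card_eq_sum_ones, Nat.cast_sum]
      refine Finset.sum_congr rfl fun h hh => ?_
      have hD := (hDdef h).1 (Finset.mem_filter.1 hh).2
      simp [ind, hD.1, hD.2]
    · intro h h1 h2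
      simp only [hDdef, hσ] at h1 h2
      have : C (vtx h) ↔ C (vtx (σ h)) := by tauto
      simp only [this]
  have hflip : ∑ h, ind (flip h) = (b : ZMod 2) := by
    rw [sum_eq_sum_crossing σ hσ hfp _ D hDσ]
    · rw [hb, ← Finset.filter_filter, Finset.card_filter, Nat.cast_sum]
      refine Finset.sum_congr rfl fun h hh => ?_
      have hD : D h := (Finset.mem_filter.1 hh).2
      have := hboth h hD
      by_cases h1 : flip h
      · simp [ind, h1, this h1]
      · by_cases h2 : flip (σ h) <;> simp [ind, h1, h2]
    · intro h h1 h2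
      simp only [hDdef, hσ] at h1 h2
      have hc : C (vtx h) ↔ C (vtx (σ h)) := by tauto
      have e1 := hsame h
      have e2 := hsame (σ h)
      rw [hσ] at e2
      have : flip h ↔ flip (σ h) := by tauto
      simp only [this]
  have hAsum : ∑ h, ind (A h) = ∑ h, ind (C (vtx h)) + ∑ h, ind (flip h) := by
    rw [← Finset.sum_add_distrib]
    refine Finset.sum_congr rfl fun h _ => ?_
    by_cases h1 : A h <;> by_cases h2 : C (vtx h) <;> simp [ind, hflipdef, h1, h2]
    decide
  have hBsum : ((∑ v, #{i | B v i} : ℕ) : ZMod 2) = r * ((#{v | C v} : ℕ) : ZMod 2) := by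
    rw [← Nat.cast_mul]
    congr 1
    rw [Finset.card_filter, Finset.mul_sum]
    refine Finset.sum_congr rfl fun v _ => ?_
    by_cases h : C v <;> simp [hBC, h]
  have htot : ((#{h | A h} + ∑ v, #{i | B v i} : ℕ) : ZMod 2) = 1 :=
    natCast_zmod_two_eq_one.2 hodd
  rw [Nat.cast_add, hcount, hAsum, hBsum, hflip, ← hCsum, hCsum'] at htot
  have hkr' : (k : ZMod 2) + r = 1 := by rw [← Nat.cast_add, hkr, hp1]
  have h2 : ∀ x : ZMod 2, x + x = 0 := by decide
  have hone : a + b = 1 → B v₀ ⟨0, hr0⟩ ∨ B v₁ ⟨0, hr0⟩ := by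
    intro h
    rw [hBC, hBC]
    exact hbridge {v | C v} (by
      rw [← h, ← hab]
      simp only [hDdef, Set.mem_ofPred_eq])
  -- The selected set has size `a + r(a + b)` modulo 2, so `b` is odd for `k` even and `a` is odd
  -- for `k` odd. An odd count of at least 3 costs `3r ≥ p` or `3k ≥ p` respectively. A count of 1
  -- with the other count positive costs `k + r = p`. Otherwise `a + b = 1`, a bridge.
  rcases hk with ⟨hke, hk3⟩ | ⟨hko, hk3⟩
  · have hk0' : (k : ZMod 2) = 0 := by
      rw [ZMod.natCast_eq_zero_iff]; exact hke.two_dvd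
    have hr1 : (r : ZMod 2) = 1 := by simpa [hk0'] using hkr'
    have hbodd : Odd b := by
      rw [← natCast_zmod_two_eq_one, ← htot, hr1]
      linear_combination -(h2 (a : ZMod 2)) - h2 (b : ZMod 2)
    by_cases hb1 : b = 1
    · by_cases ha0 : a = 0
      · right
        rw [hb1, ha0] at hcost
        exact ⟨by omega, hone (by omega)⟩
      · left
        have := Nat.mul_le_mul_left k (Nat.one_le_iff_ne_zero.2 ha0)
        rw [hb1] at hcost
        omega
    · left
      have h3 : 3 ≤ b := by rcases hbodd with ⟨m, hm⟩; omega
      have := Nat.mul_le_mul_left r h3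
      omega
  · have hk1' : (k : ZMod 2) = 1 := natCast_zmod_two_eq_one.2 hko
    have hr1 : (r : ZMod 2) = 0 := by simpa [hk1'] using hkr'
    have haodd : Odd a := by
      rw [← natCast_zmod_two_eq_one, ← htot, hr1]
      linear_combination - h2 (b : ZMod 2)
    by_cases ha1 : a = 1
    · by_cases hb0 : b = 0
      · right
        rw [ha1, hb0] at hcost
        exact ⟨by omega, hone (by omega)⟩
      · left
        have := Nat.mul_le_mul_left r (Nat.one_le_iff_ne_zero.2 hb0)
        rw [ha1] at hcost
        omega
    · left
      have h3 : 3 ≤ a := by rcases haodd with ⟨m, hm⟩; omega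
      have := Nat.mul_le_mul_left k h3
      omega

/-! ### The gadget graph and its matchings -/

open Classical in
/-- Edge weights of the factor gadget: half-edges `H` are joined to their partners with weight `k`
and to each of the `r` core vertices of their endpoint with weight `1`. -/
noncomputable def gadgetWeight {V H : Type*} (vtx : H → V) (σ : H → H) (k r : ℕ) :
    H ⊕ (V × Fin r) → H ⊕ (V × Fin r) → ℕ
  | .inl h, .inl h' => if h' = σ h then k else 0
  | .inl h, .inr c => if c.1 = vtx h then 1 else 0
  | .inr c, .inl h => if c.1 = vtx h then 1 else 0
  | .inr _, .inr _ => 0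

open Classical in
theorem gadgetWeight_comm {V H : Type*} (vtx : H → V) (σ : H → H) (hσ : ∀ h, σ (σ h) = h)
    (k r : ℕ) (x y : H ⊕ (V × Fin r)) :
    gadgetWeight vtx σ k r x y = gadgetWeight vtx σ k r y x := by
  rcases x with h | c <;> rcases y with h' | c' <;> try rfl
  have : h' = σ h ↔ h = σ h' := ⟨fun e => by rw [e, hσ], fun e => by rw [e, hσ]⟩
  simp only [gadgetWeight]
  exact if_congr this rfl rfl

/-- The factor gadget graph. -/
def gadgetGraph {V H : Type*} (vtx : H → V) (σ : H → H) (hσ : ∀ h, σ (σ h) = h)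
    (hfp : ∀ h, σ h ≠ h) (k r : ℕ) : SimpleGraph (H ⊕ (V × Fin r)) where
  Adj x y := gadgetWeight vtx σ k r x y ≠ 0
  symm := ⟨fun x y h => by rwa [gadgetWeight_comm vtx σ hσ]⟩
  loopless := ⟨fun x h => by
    rcases x with a | c
    · simp [gadgetWeight, (hfp a).symm] at h
    · simp [gadgetWeight] at h⟩

open Classical Finset in
theorem sum_core {V : Type*} [Fintype V] {r : ℕ} (u : V) (g : V × Fin r → ℕ) :
    ∑ c, (if c.1 = u then g c else 0) = ∑ i, g (u, i) := by
  rw [Fintype.sum_prod_type, Finset.sum_eq_single u]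
  · simp
  · intro v _ hv
    simp [hv]
  · simp

-- A core–half-edge pair contributes exactly when its ends disagree, whichever end lies in `K`; a
-- pair of partners contributes through its half in `K`.
open Classical Finset in
theorem gadget_cut_eq {V H : Type*} [Fintype V] [Fintype H] (vtx : H → V) (σ : H → H) (k r : ℕ)
    [DecidableEq (H ⊕ (V × Fin r))] (K : Finset (H ⊕ (V × Fin r))) :
    ∑ x ∈ K, ∑ y ∈ Kᶜ, gadgetWeight vtx σ k r x y =
      ∑ h, ((if Sum.inl h ∈ K ∧ ¬ Sum.inl (σ h) ∈ K then k else 0)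
        + #{i | ¬ (Sum.inl h ∈ K ↔ Sum.inr (vtx h, i) ∈ K)}) := by
  have h1 : ∑ x ∈ K, ∑ y ∈ Kᶜ, gadgetWeight vtx σ k r x y =
      ∑ x, ∑ y, if x ∈ K ∧ y ∉ K then gadgetWeight vtx σ k r x y else 0 := by
    rw [← Finset.sum_filter_add_sum_filter_not univ (fun x => x ∈ K)
      (fun x => ∑ y, if x ∈ K ∧ y ∉ K then gadgetWeight vtx σ k r x y else 0)]
    have e : ∑ x with x ∉ K, (∑ y, if x ∈ K ∧ y ∉ K then gadgetWeight vtx σ k r x y else 0) = 0 := by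
      refine Finset.sum_eq_zero fun x hx => Finset.sum_eq_zero fun y _ => if_neg ?_
      exact fun h => (Finset.mem_filter.1 hx).2 h.1
    rw [e, add_zero, Finset.filter_univ_mem]
    refine Finset.sum_congr rfl fun x hx => ?_
    rw [← Finset.sum_filter]
    refine Finset.sum_congr ?_ fun _ _ => rfl
    ext y
    simp [hx]
  rw [h1, Fintype.sum_sum_type]
  simp only [Fintype.sum_sum_type, gadgetWeight, ite_self, Finset.sum_const_zero, add_zero]
  rw [Finset.sum_comm (s := (univ : Finset (V × Fin r))), ← Finset.sum_add_distrib]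
  refine Finset.sum_congr rfl fun h _ => ?_
  rw [add_assoc]
  congr 1
  · rw [Finset.sum_eq_single (σ h)]
    · simp
    · intro b _ hb
      simp [hb]
    · simp
  · have e2 : ∀ (P : V × Fin r → Prop) [DecidablePred P],
        ∑ c, (if P c then if c.1 = vtx h then 1 else 0 else 0) = #{i | P (vtx h, i)} := by
      intro P _
      rw [Finset.card_filter, ← sum_core (vtx h) (fun c => if P c then 1 else 0)]
      refine Finset.sum_congr rfl fun c _ => ?_
      by_cases h3 : P c <;> simp [h3]
    rw [e2, e2, ← Finset.card_union_of_disjoint]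
    · congr 1
      ext i
      simp only [Finset.mem_union, Finset.mem_filter, Finset.mem_univ, true_and]
      tauto
    · rw [Finset.disjoint_filter]
      tauto

open Classical Finset in
/-- A `p`-regular multigraph, `p` odd, in which every set with exactly one outgoing edge contains
`v₀` or `v₁`, has a `k`-factor (for `k` even, `k ≤ 2p/3`, or `k` odd, `k ≥ p/3`). -/
theorem exists_factor_of_bridges {V H : Type*} [Fintype V] [Fintype H] (vtx : H → V) (σ : H → H)
    (hσ : ∀ h, σ (σ h) = h) (hfp : ∀ h, σ h ≠ h) (p k : ℕ) (hpodd : Odd p) (hkp : k < p)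
    (hk0 : 0 < k) (hk : (Even k ∧ 3 * k ≤ 2 * p) ∨ (Odd k ∧ p ≤ 3 * k))
    (hfib : ∀ v, #{h | vtx h = v} = p) (v₀ v₁ : V)
    (hbridge : ∀ C : Set V, #{h | vtx h ∈ C ∧ vtx (σ h) ∉ C} = 1 → v₀ ∈ C ∨ v₁ ∈ C) :
    ∃ M : Finset H, (∀ h ∈ M, σ h ∈ M) ∧ ∀ v, #{h ∈ M | vtx h = v} = k := by
  obtain ⟨r, hkr⟩ : ∃ r, k + r = p := ⟨p - k, by omega⟩
  have hr0 : 0 < r := by omega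
  have hcardH : Fintype.card H = p * Fintype.card V := by
    rw [← Finset.card_univ, Finset.card_eq_sum_card_fiberwise (f := vtx) (t := univ) (by simp),
      Finset.sum_congr rfl (fun v _ => hfib v), Finset.sum_const, smul_eq_mul, mul_comm,
      Finset.card_univ]
  have heven : Even (Fintype.card (H ⊕ (V × Fin r))) := by
    have hH : Even (Fintype.card H) := by
      rw [← Finset.card_univ]
      exact even_card_of_fixedPointFree_involution univ σ (by simp) (by simp [hσ]) (by simp [hfp])
    have hV : Even (Fintype.card V) := by
      rw [hcardH, Nat.even_mul] at hH
      exact hH.resolve_left (Nat.not_even_iff_odd.2 hpodd)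
    rw [Fintype.card_sum, Fintype.card_prod]
    exact hH.add (hV.mul_right _)
  obtain ⟨P, hP⟩ := exists_isPerfectMatching_of_weights (gadgetGraph vtx σ hσ hfp k r)
    (gadgetWeight vtx σ k r) p (by omega) (fun x y h => h) (by
      rintro (h | c)
      · rw [Fintype.sum_sum_type]
        simp only [gadgetWeight]
        have e : ∀ x, h = σ x ↔ x = σ h := fun x =>
          ⟨fun e => by rw [e, hσ], fun e => by rw [e, hσ]⟩
        simp only [e]
        rw [sum_core (vtx h) (fun _ => 1)]
        simp [hkr]
      · rw [Fintype.sum_sum_type]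
        simp only [gadgetWeight]
        have : ∑ x, (if c.1 = vtx x then 1 else 0) = p := by
          rw [← hfib c.1, Finset.card_filter]
          exact Finset.sum_congr rfl fun x _ => by simp only [eq_comm]
        simp [this])
    heven (Sum.inr (v₀, ⟨0, hr0⟩)) (Sum.inr (v₁, ⟨0, hr0⟩)) (by
      intro K hK
      rw [gadget_cut_eq]
      have hb := gadget_cut_bound vtx σ hσ hfp p k r hpodd hkr hk0 hr0 hk hfib v₀ v₁ hbridge
        (fun h => Sum.inl h ∈ K) (fun v i => Sum.inr (v, i) ∈ K)
      convert hb ?_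
      convert hK using 1
      have e1 : K.card = ∑ x, if x ∈ K then 1 else 0 := by simp
      rw [e1, Fintype.sum_sum_type, Fintype.sum_prod_type]
      simp only [Finset.card_filter]
      congr!)
  rw [SimpleGraph.Subgraph.isPerfectMatching_iff] at hP
  refine ⟨univ.filter fun h => P.Adj (Sum.inl h) (Sum.inl (σ h)), ?_, ?_⟩
  · intro h hh
    simp only [Finset.mem_filter, Finset.mem_univ, true_and, hσ] at hh ⊢
    exact hh.symm
  · intro v
    -- The half-edges at `v` not matched to their partners correspond bijectively to the `r` core
    -- vertices of `v`.
    have hcore : #{h | vtx h = v ∧ ¬ P.Adj (Sum.inl h) (Sum.inl (σ h))} = r := by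
      refine Eq.trans ?_ (Finset.card_fin r)
      have hex : ∀ i : Fin r, ∃ h : H, P.Adj (Sum.inr (v, i)) (Sum.inl h) ∧ vtx h = v := by
        intro i
        obtain ⟨y, hy, -⟩ := hP (Sum.inr (v, i))
        have := P.adj_sub hy
        rcases y with h | c
        · refine ⟨h, hy, ?_⟩
          by_contra hne
          simp [gadgetGraph, gadgetWeight, Ne.symm hne] at this
        · simp [gadgetGraph, gadgetWeight] at this
      choose g hg hgv using hex
      symm
      refine Finset.card_bij (fun i _ => g i) ?_ ?_ ?_
      · intro i _
        simp only [Finset.mem_filter, Finset.mem_univ, true_and]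
        refine ⟨hgv i, fun h => ?_⟩
        have := (hP (Sum.inl (g i))).unique h (hg i).symm
        simp at this
      · intro i _ j _ hij
        have hj := hg j
        rw [← show g i = g j from hij] at hj
        have := (hP (Sum.inl (g i))).unique (hg i).symm hj.symm
        simpa using this
      · intro h hh
        simp only [Finset.mem_filter, Finset.mem_univ, true_and] at hh
        obtain ⟨y, hy, -⟩ := hP (Sum.inl h)
        have hadj := P.adj_sub hy
        rcases y with h' | ⟨u, i⟩
        · exfalso
          by_cases e : h' = σ h
          · exact hh.2 (e ▸ hy)
          · simp [gadgetGraph, gadgetWeight, e] at hadj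
        · by_cases e : u = vtx h
          · have euv : u = v := e.trans hh.1
            subst euv
            refine ⟨i, Finset.mem_univ _, ?_⟩
            have := (hP (Sum.inr (u, i))).unique (hg i) hy.symm
            simpa using this
          · simp [gadgetGraph, gadgetWeight, e] at hadj
    have := Finset.card_filter_add_card_filter_not (s := univ.filter fun h => vtx h = v)
      (fun h => P.Adj (Sum.inl h) (Sum.inl (σ h)))
    rw [Finset.filter_filter, Finset.filter_filter, hcore, hfib] at this
    rw [Finset.filter_filter]
    simp only [and_comm] at this ⊢
    omega

/-! ### Regular parts in the presence of bridges -/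

open Classical Finset in
/-- If no proper part of `C` is joined to the rest of `C` by at most one edge, then there is a
`k`-factor on `C`, where the edges leaving `C` may be used freely. -/
theorem exists_factor_of_no_internal_bridge {V H : Type*} [Fintype H] (vtx : H → V) (σ : H → H)
    (hσ : ∀ h, σ (σ h) = h) (hfp : ∀ h, σ h ≠ h) (p k : ℕ) (hpodd : Odd p) (hkp : k < p)
    (hk0 : 0 < k) (hk : (Even k ∧ 3 * k ≤ 2 * p) ∨ (Odd k ∧ p ≤ 3 * k))
    (C : Finset V) (hC : C.Nonempty) (hfib : ∀ v ∈ C, #{h | vtx h = v} = p)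
    (hbridge : ∀ D ⊆ C, D.Nonempty → D ≠ C →
      2 ≤ #{h | vtx h ∈ D ∧ vtx (σ h) ∈ C \ D}) :
    ∃ M : Finset H, (∀ h ∈ M, vtx h ∈ C) ∧ (∀ h ∈ M, vtx (σ h) ∈ C → σ h ∈ M) ∧
      ∀ v ∈ C, #{h ∈ M | vtx h = v} = k := by
  -- Two copies of `C` are taken, and each half-edge leaving `C` is joined to its twin in the other
  -- copy, which restores `p`-regularity.
  let H' := {h // vtx h ∈ C} × Bool
  let vtx' : H' → C × Bool := fun x => (⟨vtx x.1, x.1.2⟩, x.2)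
  let σ' : H' → H' := fun x =>
    if hx : vtx (σ x.1) ∈ C then (⟨σ x.1, hx⟩, x.2) else (x.1, !x.2)
  have hin : ∀ x : H', ∀ hx : vtx (σ x.1) ∈ C, σ' x = (⟨σ x.1, hx⟩, x.2) :=
    fun x hx => dif_pos hx
  have hout : ∀ x : H', vtx (σ x.1) ∉ C → σ' x = (x.1, !x.2) := fun x hx => dif_neg hx
  have hcount : ∀ (N : Finset H') (v : V) (hv : v ∈ C) (i : Bool),
      #{x ∈ N | vtx' x = (⟨v, hv⟩, i)} =
        #{h | vtx h = v ∧ ∃ hh : vtx h ∈ C, ((⟨h, hh⟩, i) : H') ∈ N} := by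
    intro N v hv i
    refine Finset.card_bij (fun x _ => x.1.1) ?_ ?_ ?_
    · rintro ⟨⟨h, hh⟩, j⟩ hx
      simp only [Finset.mem_filter, vtx', Prod.mk.injEq, Subtype.mk.injEq] at hx
      obtain ⟨h1, h2, rfl⟩ := hx
      simp only [Finset.mem_filter, Finset.mem_univ, true_and]
      exact ⟨h2, hh, h1⟩
    · rintro ⟨⟨h, hh⟩, j⟩ hx ⟨⟨h', hh'⟩, j'⟩ hx' heq
      simp only [Finset.mem_filter, vtx', Prod.mk.injEq, Subtype.mk.injEq] at hx hx' heq
      obtain ⟨-, -, rfl⟩ := hx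
      obtain ⟨-, -, rfl⟩ := hx'
      subst heq
      rfl
    · intro h hh
      simp only [Finset.mem_filter, Finset.mem_univ, true_and] at hh
      obtain ⟨rfl, h1, h2⟩ := hh
      exact ⟨(⟨h, h1⟩, i), by simp [vtx', h2], rfl⟩
  obtain ⟨v, hv⟩ := hC
  obtain ⟨M, hM, hMk⟩ := exists_factor_of_bridges vtx' σ' (by
      rintro x
      by_cases hx : vtx (σ x.1) ∈ C
      · rw [hin x hx, hin]
        · simp [hσ]
        · simp [hσ, x.1.2]
      · rw [hout x hx, hout]
        · simp
        · exact hx)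
    (by
      rintro x
      by_cases hx : vtx (σ x.1) ∈ C
      · rw [hin x hx]
        intro h
        exact hfp x.1 (congrArg (fun y : H' => (y.1 : H)) h)
      · rw [hout x hx]
        intro h
        have : (!x.2) = x.2 := congrArg Prod.snd h
        simp at this)
    p k hpodd hkp hk0 hk (by
      rintro ⟨⟨v, hv⟩, i⟩
      refine (Eq.trans (by congr!) (hcount univ v hv i)).trans ?_
      rw [← hfib v hv]
      congr 1
      ext h
      simp only [Finset.mem_filter, Finset.mem_univ, true_and, exists_prop, and_true]
      exact ⟨fun h => h.1, fun h => ⟨h, h ▸ hv⟩⟩)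
    -- The exceptional vertices are the two copies of one vertex. A set avoiding both meets each
    -- copy of `C` in a proper subset, which is empty or already sends out two edges.
    (⟨v, hv⟩, false) (⟨v, hv⟩, true) (by
      intro S hS
      by_contra hcon
      push Not at hcon
      have hempty : ∀ i : Bool, (⟨v, hv⟩, i) ∉ S → ∀ u : C, (u, i) ∉ S := by
        intro i hi u hu
        have h2 := hbridge (C.filter fun a => ∃ ha : a ∈ C, ((⟨a, ha⟩, i) : C × Bool) ∈ S)
          (Finset.filter_subset _ _) ⟨u, by simpa using hu⟩ (by
            intro e
            have := e.symm ▸ hv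
            rw [Finset.mem_filter] at this
            obtain ⟨-, _, h⟩ := this
            exact hi h)
        obtain ⟨a, ha, b, hb, hab⟩ := Finset.one_lt_card.1 h2
        rw [Finset.card_eq_one] at hS
        obtain ⟨z, hz⟩ := hS
        have key : ∀ h, h ∈ univ.filter (fun h =>
            vtx h ∈ (C.filter fun a => ∃ ha : a ∈ C, ((⟨a, ha⟩, i) : C × Bool) ∈ S) ∧
            vtx (σ h) ∈ C \ (C.filter fun a => ∃ ha : a ∈ C, ((⟨a, ha⟩, i) : C × Bool) ∈ S)) →
            (z.1 : H) = h := by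
          intro h hh
          simp only [Finset.mem_filter, Finset.mem_univ, true_and, Finset.mem_sdiff] at hh
          obtain ⟨⟨h1, h2, h3⟩, h4, h5⟩ := hh
          have : ((⟨h, h1⟩, i) : H') ∈ ({z} : Finset H') := by
            rw [← hz, Finset.mem_filter]
            refine ⟨Finset.mem_univ _, h3, ?_⟩
            rw [hin _ h4]
            exact fun h6 => h5 ⟨h4, h4, h6⟩
          rw [← Finset.mem_singleton.1 this]
        exact hab ((key a ha).symm.trans (key b hb))
      obtain ⟨x, hx⟩ := Finset.card_pos.1 (by rw [hS]; exact Nat.one_pos)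
      rw [Finset.mem_filter] at hx
      rcases hx2 : (vtx' x) with ⟨u, _ | _⟩
      · exact hempty false hcon.1 u (hx2 ▸ hx.2.1)
      · exact hempty true hcon.2 u (hx2 ▸ hx.2.1))
  refine ⟨univ.filter fun h => ∃ hh : vtx h ∈ C, ((⟨h, hh⟩, false) : H') ∈ M, ?_, ?_, ?_⟩
  · intro h hh
    exact (Finset.mem_filter.1 hh).2.1
  · intro h hh hs
    obtain ⟨h1, h2⟩ := (Finset.mem_filter.1 hh).2
    refine Finset.mem_filter.2 ⟨Finset.mem_univ _, hs, ?_⟩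
    have := hM _ h2
    rwa [hin _ hs] at this
  · intro u hu
    rw [← hMk (⟨u, hu⟩, false)]
    refine Eq.trans ?_ ((hcount M u hu false).symm.trans (by congr!))
    rw [Finset.filter_filter]
    congr 1
    ext h
    simp only [Finset.mem_filter, and_comm]

open Classical Finset in
/-- A multigraph that is `p`-regular on `C`, `p` odd, has a non-empty `k`-regular part on `C` for
odd `k < p ≤ 3k`, where the edges leaving `C` may be used freely. -/
theorem exists_odd_regular_part_on {V H : Type*} [Fintype H] (vtx : H → V) (σ : H → H)
    (hσ : ∀ h, σ (σ h) = h) (hfp : ∀ h, σ h ≠ h) (p k : ℕ) (hpodd : Odd p) (hkp : k < p)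
    (hkodd : Odd k) (hk : p ≤ 3 * k)
    (C : Finset V) (hC : C.Nonempty) (hfib : ∀ v ∈ C, #{h | vtx h = v} = p) :
    ∃ M : Finset H, M.Nonempty ∧ (∀ h ∈ M, vtx h ∈ C) ∧
      (∀ h ∈ M, vtx (σ h) ∈ C → σ h ∈ M) ∧
      ∀ v ∈ C, #{h ∈ M | vtx h = v} = 0 ∨ #{h ∈ M | vtx h = v} = k := by
  induction C using Finset.strongInduction with
  | H C ih =>
  by_cases hbridge : ∀ D ⊆ C, D.Nonempty → D ≠ C → 2 ≤ #{h | vtx h ∈ D ∧ vtx (σ h) ∈ C \ D}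
  · obtain ⟨M, hM1, hM2, hM3⟩ := exists_factor_of_no_internal_bridge vtx σ hσ hfp p k hpodd hkp
      hkodd.pos (Or.inr ⟨hkodd, hk⟩) C hC hfib hbridge
    refine ⟨M, ?_, hM1, hM2, fun v hv => Or.inr (hM3 v hv)⟩
    obtain ⟨v, hv⟩ := hC
    have : 0 < #{h ∈ M | vtx h = v} := by rw [hM3 v hv]; exact hkodd.pos
    obtain ⟨h, hh⟩ := Finset.card_pos.1 this
    exact ⟨h, (Finset.mem_filter.1 hh).1⟩
  · push Not at hbridge
    obtain ⟨D, hDC, hD, hne, hcut⟩ := hbridge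
    have hcut' : ∀ x y, vtx x ∈ D → vtx (σ x) ∈ C \ D → vtx y ∈ D → vtx (σ y) ∈ C \ D → x = y := by
      intro x y h1 h2 h3 h4
      exact Finset.card_le_one.1 (Nat.lt_succ_iff.1 hcut) x
        (Finset.mem_filter.2 ⟨Finset.mem_univ _, h1, h2⟩) y
        (Finset.mem_filter.2 ⟨Finset.mem_univ _, h3, h4⟩)
    have hD' : (C \ D).Nonempty := by
      rw [Finset.sdiff_nonempty]
      exact fun h => hne (hDC.antisymm h)
    obtain ⟨M₁, hn₁, hs₁, hc₁, hf₁⟩ := ih D (hDC.ssubset_of_ne hne) hD (fun v hv => hfib v (hDC hv))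
    obtain ⟨M₂, hn₂, hs₂, hc₂, hf₂⟩ := ih (C \ D)
      (Finset.sdiff_ssubset hDC hD) hD' (fun v hv => hfib v (Finset.sdiff_subset hv))
    have hz₁ : ∀ v, v ∉ D → #{h ∈ M₁ | vtx h = v} = 0 := by
      intro v hv
      rw [Finset.card_eq_zero, Finset.filter_eq_empty_iff]
      rintro h hh rfl
      exact hv (hs₁ h hh)
    have hz₂ : ∀ v, v ∈ D → #{h ∈ M₂ | vtx h = v} = 0 := by
      intro v hv
      rw [Finset.card_eq_zero, Finset.filter_eq_empty_iff]
      rintro h hh rfl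
      exact (Finset.mem_sdiff.1 (hs₂ h hh)).2 hv
    have hF₁ : ∀ v ∈ C, #{h ∈ M₁ | vtx h = v} = 0 ∨ #{h ∈ M₁ | vtx h = v} = k := by
      intro v _
      by_cases hvD : v ∈ D
      · exact hf₁ v hvD
      · exact Or.inl (hz₁ v hvD)
    have hF₂ : ∀ v ∈ C, #{h ∈ M₂ | vtx h = v} = 0 ∨ #{h ∈ M₂ | vtx h = v} = k := by
      intro v hv
      by_cases hvD : v ∈ D
      · exact Or.inl (hz₂ v hvD)
      · exact hf₂ v (Finset.mem_sdiff.2 ⟨hv, hvD⟩)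
    by_cases hx₁ : ∃ x ∈ M₁, vtx (σ x) ∈ C \ D
    swap
    · push Not at hx₁
      refine ⟨M₁, hn₁, fun h hh => hDC (hs₁ h hh), fun h hh hc => hc₁ h hh ?_, hF₁⟩
      by_contra hcon
      exact hx₁ h hh (Finset.mem_sdiff.2 ⟨hc, hcon⟩)
    by_cases hx₂ : ∃ y ∈ M₂, vtx (σ y) ∈ D
    swap
    · push Not at hx₂
      refine ⟨M₂, hn₂, fun h hh => Finset.sdiff_subset (hs₂ h hh), fun h hh hc => hc₂ h hh ?_, hF₂⟩
      exact Finset.mem_sdiff.2 ⟨hc, hx₂ h hh⟩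
    obtain ⟨x, hxM, hx⟩ := hx₁
    obtain ⟨y, hyM, hy⟩ := hx₂
    -- Both solutions use the bridge, so its two halves fit together in the union.
    have hxy : x = σ y := hcut' x (σ y) (hs₁ x hxM) hx hy (by rw [hσ]; exact hs₂ y hyM)
    refine ⟨M₁ ∪ M₂, hn₁.mono Finset.subset_union_left, ?_, ?_, ?_⟩
    · intro h hh
      rcases Finset.mem_union.1 hh with hh | hh
      · exact hDC (hs₁ h hh)
      · exact Finset.sdiff_subset (hs₂ h hh)
    · intro h hh hc
      rw [Finset.mem_union] at hh ⊢
      rcases hh with hh | hh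
      · by_cases hD : vtx (σ h) ∈ D
        · exact Or.inl (hc₁ h hh hD)
        · right
          have : h = x := hcut' h x (hs₁ h hh) (Finset.mem_sdiff.2 ⟨hc, hD⟩) (hs₁ x hxM) hx
          rwa [this, hxy, hσ]
      · by_cases hD : vtx (σ h) ∈ D
        · left
          have : σ h = x := hcut' (σ h) x hD (by rw [hσ]; exact hs₂ h hh) (hs₁ x hxM) hx
          rwa [this]
        · exact Or.inr (hc₂ h hh (Finset.mem_sdiff.2 ⟨hc, hD⟩))
    · intro v hv
      have hdisj : Disjoint M₁ M₂ := by
        rw [Finset.disjoint_left]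
        intro h h1 h2
        exact (Finset.mem_sdiff.1 (hs₂ h h2)).2 (hs₁ h h1)
      rw [Finset.filter_union, Finset.card_union_of_disjoint
        (Finset.disjoint_filter_filter hdisj)]
      by_cases hvD : v ∈ D
      · rw [hz₂ v hvD, add_zero]
        exact hF₁ v hv
      · rw [hz₁ v hvD, zero_add]
        exact hF₂ v hv

open Classical Finset in
/-- A multigraph that is `p`-regular on `C`, `p` odd, with at most one edge leaving `C`, has a
non-empty `k`-regular part inside `C` for even `k ≤ 2p/3`. -/
theorem exists_even_regular_part_on {V H : Type*} [Fintype H] (vtx : H → V) (σ : H → H)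
    (hσ : ∀ h, σ (σ h) = h) (hfp : ∀ h, σ h ≠ h) (p k : ℕ) (hpodd : Odd p) (hk0 : 0 < k)
    (hkeven : Even k) (hk : 3 * k ≤ 2 * p)
    (C : Finset V) (hC : C.Nonempty) (hfib : ∀ v ∈ C, #{h | vtx h = v} = p)
    (hexit : ∀ x y, vtx x ∈ C → vtx (σ x) ∉ C → vtx y ∈ C → vtx (σ y) ∉ C → x = y) :
    ∃ M : Finset H, M.Nonempty ∧ (∀ h ∈ M, vtx h ∈ C) ∧ (∀ h ∈ M, σ h ∈ M) ∧
      ∀ v ∈ C, #{h ∈ M | vtx h = v} = 0 ∨ #{h ∈ M | vtx h = v} = k := by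
  induction C using Finset.strongInduction with
  | H C ih =>
  by_cases hbridge : ∀ D ⊆ C, D.Nonempty → D ≠ C → 2 ≤ #{h | vtx h ∈ D ∧ vtx (σ h) ∈ C \ D}
  · obtain ⟨M, hM1, hM2, hM3⟩ := exists_factor_of_no_internal_bridge vtx σ hσ hfp p k hpodd
      (by omega) hk0 (Or.inl ⟨hkeven, hk⟩) C hC hfib hbridge
    refine ⟨M, ?_, hM1, ?_, fun v hv => Or.inr (hM3 v hv)⟩
    · obtain ⟨v, hv⟩ := hC
      have : 0 < #{h ∈ M | vtx h = v} := by rw [hM3 v hv]; exact hk0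
      obtain ⟨h, hh⟩ := Finset.card_pos.1 this
      exact ⟨h, (Finset.mem_filter.1 hh).1⟩
    have hMeven : Even M.card := by
      rw [Finset.card_eq_sum_card_fiberwise (f := vtx) (t := C) hM1,
        Finset.sum_congr rfl hM3, Finset.sum_const, smul_eq_mul]
      exact hkeven.mul_left _
    have hineven : Even #{h ∈ M | vtx (σ h) ∈ C} := by
      refine even_card_of_fixedPointFree_involution _ σ ?_ (fun h _ => hσ h) (fun h _ => hfp h)
      intro h hh
      rw [Finset.mem_filter] at hh ⊢
      exact ⟨hM2 h hh.1 hh.2, by rw [hσ]; exact hM1 h hh.1⟩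
    -- The half-edges in `M` that leave `C` are even in number and at most one.
    have hout : #{h ∈ M | ¬ vtx (σ h) ∈ C} = 0 := by
      have hle : #{h ∈ M | ¬ vtx (σ h) ∈ C} ≤ 1 := by
        rw [Finset.card_le_one]
        intro x hx y hy
        rw [Finset.mem_filter] at hx hy
        exact hexit x y (hM1 x hx.1) hx.2 (hM1 y hy.1) hy.2
      have hsum := Finset.card_filter_add_card_filter_not (s := M) (fun h => vtx (σ h) ∈ C)
      rcases hMeven with ⟨a, ha⟩
      rcases hineven with ⟨b, hb⟩
      omega
    intro h hh
    refine hM2 h hh ?_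
    by_contra hcon
    rw [Finset.card_eq_zero, Finset.filter_eq_empty_iff] at hout
    exact hout hh hcon
  · push Not at hbridge
    obtain ⟨D, hDC, hD, hne, hcut⟩ := hbridge
    have hcut' : ∀ x y, vtx x ∈ D → vtx (σ x) ∈ C \ D → vtx y ∈ D → vtx (σ y) ∈ C \ D → x = y := by
      intro x y h1 h2 h3 h4
      exact Finset.card_le_one.1 (Nat.lt_succ_iff.1 hcut) x
        (Finset.mem_filter.2 ⟨Finset.mem_univ _, h1, h2⟩) y
        (Finset.mem_filter.2 ⟨Finset.mem_univ _, h3, h4⟩)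
    have hD' : (C \ D).Nonempty := by
      rw [Finset.sdiff_nonempty]
      exact fun h => hne (hDC.antisymm h)
    -- One side of the bridge misses the exit of `C`, so the bridge is its only possible exit.
    obtain ⟨E, hEC, hE, hEexit⟩ : ∃ E ⊂ C, E.Nonempty ∧
        ∀ x y, vtx x ∈ E → vtx (σ x) ∉ E → vtx y ∈ E → vtx (σ y) ∉ E → x = y := by
      by_cases hx : ∃ x, vtx x ∈ D ∧ vtx (σ x) ∉ C
      · obtain ⟨z, hz1, hz2⟩ := hx
        have hin : ∀ x, vtx x ∈ C \ D → vtx (σ x) ∉ C \ D → vtx (σ x) ∈ D := by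
          intro x h1 h2
          rw [Finset.mem_sdiff] at h1 h2
          by_contra hcon
          have h3 : vtx (σ x) ∉ C := fun h => h2 ⟨h, hcon⟩
          have := hexit x z h1.1 h3 (hDC hz1) hz2
          exact h1.2 (this ▸ hz1)
        refine ⟨C \ D, Finset.sdiff_ssubset hDC hD, hD', ?_⟩
        intro x y h1 h2 h3 h4
        have := hcut' (σ x) (σ y) (hin x h1 h2) (by rwa [hσ]) (hin y h3 h4) (by rwa [hσ])
        rw [← hσ x, this, hσ]
      · push Not at hx
        refine ⟨D, hDC.ssubset_of_ne hne, hD, ?_⟩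
        intro x y h1 h2 h3 h4
        exact hcut' x y h1 (Finset.mem_sdiff.2 ⟨hx x h1, h2⟩) h3
          (Finset.mem_sdiff.2 ⟨hx y h3, h4⟩)
    obtain ⟨M, hM1, hM2, hM3, hM4⟩ := ih E hEC hE (fun v hv => hfib v (hEC.1 hv)) hEexit
    refine ⟨M, hM1, fun h hh => hEC.1 (hM2 h hh), hM3, fun v _ => ?_⟩
    by_cases hvE : v ∈ E
    · exact hM4 v hvE
    · left
      rw [Finset.card_eq_zero, Finset.filter_eq_empty_iff]
      rintro h hh rfl
      exact hvE (hM2 h hh)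

/-- Every `p`-regular part of a multigraph, `p` odd, contains a `k`-regular part if
`k ≤ 2p/3` is even, or if `k ≤ p ≤ 3k` is odd. -/
theorem exists_regular_part_step {V H : Type*} [Fintype H] [DecidableEq V] (vtx : H → V)
    (σ : H → H)
    (hσ : ∀ h, σ (σ h) = h) (hfp : ∀ h, σ h ≠ h) (p k : ℕ) (hpodd : Odd p) (hk0 : 0 < k)
    (hk : (Even k ∧ 3 * k ≤ 2 * p) ∨ (Odd k ∧ k < p ∧ p ≤ 3 * k))
    (N : Finset H) (hN : N.Nonempty) (hNσ : ∀ h ∈ N, σ h ∈ N)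
    (hfib : ∀ v, (N.filter fun h => vtx h = v).card = 0 ∨ (N.filter fun h => vtx h = v).card = p) :
    ∃ M ⊆ N, M.Nonempty ∧ (∀ h ∈ M, σ h ∈ M) ∧
      ∀ v, (M.filter fun h => vtx h = v).card = 0 ∨ (M.filter fun h => vtx h = v).card = k := by
  classical
  let vtx' : N → V := fun h => vtx h
  let σ' : N → N := fun h => ⟨σ h, hNσ h h.2⟩
  let C : Finset V := N.image vtx
  have hC : C.Nonempty := hN.image _
  have hmem : ∀ h : N, vtx' h ∈ C := fun h => Finset.mem_image_of_mem _ h.2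
  have hcount : ∀ (M : Finset N) (v : V),
      ((M.map (Function.Embedding.subtype _)).filter fun h => vtx h = v).card =
        (M.filter fun h => vtx' h = v).card := by
    intro M v
    rw [Finset.filter_map, Finset.card_map]
    rfl
  have hfib' : ∀ v ∈ C, (Finset.univ.filter fun h => vtx' h = v).card = p := by
    intro v hv
    rw [← hcount]
    have : (Finset.univ : Finset N).map (Function.Embedding.subtype _) = N := by
      ext; simp
    rw [this]
    refine (hfib v).resolve_left ?_
    obtain ⟨h, hh, rfl⟩ := Finset.mem_image.1 hv
    exact Finset.card_ne_zero.2 ⟨h, Finset.mem_filter.2 ⟨hh, rfl⟩⟩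
  have hσ' : ∀ h, σ' (σ' h) = h := fun h => Subtype.ext (hσ h)
  have hfp' : ∀ h, σ' h ≠ h := fun h e => hfp h (congrArg Subtype.val e)
  obtain ⟨M, hM1, hM2, hM3⟩ : ∃ M : Finset N, M.Nonempty ∧ (∀ h ∈ M, σ' h ∈ M) ∧
      ∀ v ∈ C, (M.filter fun h => vtx' h = v).card = 0 ∨
        (M.filter fun h => vtx' h = v).card = k := by
    rcases hk with ⟨hke, hk⟩ | ⟨hko, hkp, hk⟩
    · obtain ⟨M, h1, -, h2, h3⟩ := exists_even_regular_part_on vtx' σ' hσ' hfp' p k hpodd hk0 hke hk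
        C hC (by convert hfib') (fun x _ _ h => absurd (hmem _) h)
      exact ⟨M, h1, h2, by convert h3⟩
    · obtain ⟨M, h1, -, h2, h3⟩ := exists_odd_regular_part_on vtx' σ' hσ' hfp' p k hpodd hkp hko hk
        C hC (by convert hfib')
      exact ⟨M, h1, fun h hh => h2 h hh (hmem _), by convert h3⟩
  refine ⟨M.map (Function.Embedding.subtype _), ?_, hM1.map, ?_, ?_⟩
  · intro h hh
    obtain ⟨a, -, rfl⟩ := Finset.mem_map.1 hh
    exact a.2
  · intro h hh
    obtain ⟨a, ha, rfl⟩ := Finset.mem_map.1 hh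
    exact Finset.mem_map.2 ⟨σ' a, hM2 a ha, rfl⟩
  · intro v
    rw [hcount]
    by_cases hv : v ∈ C
    · exact hM3 v hv
    · left
      rw [Finset.card_eq_zero, Finset.filter_eq_empty_iff]
      rintro h - rfl
      exact hv (hmem h)

/-- A `p`-regular part of a multigraph, `p` odd, contains a `k`-regular part if `k ≤ 2p/3` is even,
or if `k ≤ p` is odd. -/
theorem exists_regular_part {V H : Type*} [Fintype H] [DecidableEq V] (vtx : H → V)
    (σ : H → H)
    (hσ : ∀ h, σ (σ h) = h) (hfp : ∀ h, σ h ≠ h) (k : ℕ) (hk0 : 0 < k) (p : ℕ) (hpodd : Odd p)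
    (hk : (Even k ∧ 3 * k ≤ 2 * p) ∨ (Odd k ∧ k ≤ p))
    (N : Finset H) (hN : N.Nonempty) (hNσ : ∀ h ∈ N, σ h ∈ N)
    (hfib : ∀ v, (N.filter fun h => vtx h = v).card = 0 ∨ (N.filter fun h => vtx h = v).card = p) :
    ∃ M ⊆ N, M.Nonempty ∧ (∀ h ∈ M, σ h ∈ M) ∧
      ∀ v, (M.filter fun h => vtx h = v).card = 0 ∨ (M.filter fun h => vtx h = v).card = k := by
  rcases hk with ⟨hke, hk⟩ | ⟨hko, hk⟩
  · exact exists_regular_part_step vtx σ hσ hfp p k hpodd hk0 (Or.inl ⟨hke, hk⟩) N hN hNσ hfib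
  · obtain ⟨m, rfl⟩ : ∃ m, p = k + 2 * m := by
      obtain ⟨a, ha⟩ := hpodd
      obtain ⟨b, hb⟩ := hko
      exact ⟨a - b, by omega⟩
    clear hk
    induction m generalizing N with
    | zero => exact ⟨N, Finset.Subset.refl _, hN, hNσ, hfib⟩
    | succ m ih =>
      have hodd : Odd (k + 2 * m) := hko.add_even (even_two_mul m)
      -- Lowering the degree by 2 always satisfies `q + 2 ≤ 3q` for `q ≥ 1`.
      obtain ⟨N', hN'N, h1, h2, h3⟩ := exists_regular_part_step vtx σ hσ hfp (k + 2 * (m + 1))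
        (k + 2 * m) hpodd (by omega) (Or.inr ⟨hodd, by omega, by omega⟩) N hN hNσ hfib
      obtain ⟨M, hM, h⟩ := ih N' h1 h2 hodd h3
      exact ⟨M, hM.trans hN'N, h⟩

/-! ### Degrees divisible by a prime -/

open Classical MvPolynomial in
/-- The Alon–Friedland–Kalai argument: an incidence structure with more than `(p - 1)|V|` blocks
has a non-empty subfamily of blocks covering every point a multiple of `p` times. -/
theorem exists_nonempty_dvd_card {V E : Type*} [Fintype V] [Fintype E] (p : ℕ) (hp : p.Prime)
    (inc : V → E → Prop) [∀ v, DecidablePred (inc v)]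
    (hcard : (p - 1) * Fintype.card V < Fintype.card E) :
    ∃ S : Finset E, S.Nonempty ∧ ∀ v, p ∣ (S.filter fun e => inc v e).card := by
  have : Fact p.Prime := ⟨hp⟩
  have hp1 : p - 1 ≠ 0 := Nat.sub_ne_zero_of_lt hp.one_lt
  let f : V → MvPolynomial E (ZMod p) := fun v => ∑ e with inc v e, X e ^ (p - 1)
  have hdeg : ∑ v, (f v).totalDegree < Fintype.card E := by
    refine lt_of_le_of_lt ?_ hcard
    calc ∑ v, (f v).totalDegree ≤ ∑ _v : V, (p - 1) := by
          refine Finset.sum_le_sum fun v _ => totalDegree_finsetSum_le fun e _ => ?_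
          rw [totalDegree_X_pow]
      _ = (p - 1) * Fintype.card V := by
          rw [Finset.sum_const, smul_eq_mul, Finset.card_univ, mul_comm]
  have hdvd := char_dvd_card_solutions_of_fintype_sum_lt p hdeg
  have heval : ∀ (x : E → ZMod p) v, eval x (f v) = ∑ e with inc v e, x e ^ (p - 1) := by
    intro x v
    simp [f]
  have hzero : ∀ v, eval (0 : E → ZMod p) (f v) = 0 := by
    intro v
    rw [heval]
    exact Finset.sum_eq_zero fun e _ => by simp [hp1]
  -- The number of common roots is a positive multiple of `p`, so there is one besides zero.
  have hlt : 1 < Fintype.card {x : E → ZMod p // ∀ v, eval x (f v) = 0} := by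
    have hpos : 0 < Fintype.card {x : E → ZMod p // ∀ v, eval x (f v) = 0} :=
      Fintype.card_pos_iff.2 ⟨⟨0, hzero⟩⟩
    exact hp.one_lt.trans_le (Nat.le_of_dvd hpos hdvd)
  obtain ⟨⟨x, hx⟩, hne⟩ := Fintype.exists_ne_of_one_lt_card hlt ⟨0, hzero⟩
  refine ⟨Finset.univ.filter fun e => x e ≠ 0, ?_, ?_⟩
  · by_contra hcon
    apply hne
    rw [Finset.not_nonempty_iff_eq_empty, Finset.filter_eq_empty_iff] at hcon
    refine Subtype.ext (funext fun e => ?_)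
    simpa using hcon (Finset.mem_univ e)
  · intro v
    rw [← ZMod.natCast_eq_zero_iff]
    refine Eq.trans ?_ (hx v)
    rw [heval, Finset.filter_filter, Finset.card_filter,
      Nat.cast_sum, Finset.sum_filter]
    refine Finset.sum_congr rfl fun e _ => ?_
    by_cases h1 : inc v e
    · by_cases h2 : x e = 0
      · simp [h1, h2, hp1]
      · simp [h1, h2, ZMod.pow_card_sub_one_eq_one h2]
    · simp [h1]

/-! ### Splitting vertices and returning to simple graphs -/

theorem card_fin_div_eq (p m n : ℕ) (hp : 0 < p) :
    (Finset.univ.filter fun i : Fin (p * m) => (i : ℕ) / p = n).card = 0 ∨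
      (Finset.univ.filter fun i : Fin (p * m) => (i : ℕ) / p = n).card = p := by
  have h : ∀ i, i / p = n ↔ p * n ≤ i ∧ i < p * n + p := by
    intro i
    rw [Nat.div_eq_iff hp, mul_comm n p]
    omega
  by_cases hn : n < m
  · right
    have hle : p * n + p ≤ p * m := by
      rw [← Nat.mul_succ]
      exact Nat.mul_le_mul_left p hn
    have h2 : (Finset.univ.filter fun i : Fin (p * m) => (i : ℕ) / p = n).map Fin.valEmbedding =
        Finset.Ico (p * n) (p * n + p) := by
      ext i
      simp only [Finset.mem_map, Finset.mem_filter, Finset.mem_univ, true_and, h, Finset.mem_Ico,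
        Fin.valEmbedding_apply]
      constructor
      · rintro ⟨a, ha, rfl⟩
        exact ha
      · intro hi
        exact ⟨⟨i, by omega⟩, hi, rfl⟩
    rw [← Finset.card_map Fin.valEmbedding, h2, Nat.card_Ico]
    omega
  · left
    rw [Finset.card_eq_zero, Finset.filter_eq_empty_iff]
    intro i _ hi
    have h1 := ((h i).1 hi).1
    have h2 := Nat.mul_le_mul_left p (not_lt.1 hn)
    omega

/-- A map all of whose fibres have size divisible by `p` can be refined to one with fibres of
size `p`. -/
theorem exists_refinement_of_dvd {V H : Type*} [DecidableEq V] (vtx : H → V) (p : ℕ) (hp : 0 < p)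
    (N : Finset H) (hN : ∀ v, p ∣ (N.filter fun h => vtx h = v).card) :
    ∃ g : H → ℕ, ∀ c : V × ℕ, (N.filter fun h => (vtx h, g h) = c).card = 0 ∨
      (N.filter fun h => (vtx h, g h) = c).card = p := by
  classical
  choose m hm using hN
  let e : ∀ v, (N.filter fun h => vtx h = v) ≃ Fin (p * m v) := fun v =>
    (Finset.equivFin _).trans (finCongr (hm v))
  let g : H → ℕ := fun h =>
    -- Each fibre is enumerated and cut into consecutive blocks of length `p`; the value outside `N`
    -- is irrelevant.
    if hh : h ∈ N.filter (fun x => vtx x = vtx h) then (e (vtx h) ⟨h, hh⟩ : ℕ) / p else 0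
  refine ⟨g, ?_⟩
  rintro ⟨v, n⟩
  have : (N.filter fun h => (vtx h, g h) = (v, n)).card =
      (Finset.univ.filter fun i : Fin (p * m v) => (i : ℕ) / p = n).card := by
    symm
    have hg : ∀ i : Fin (p * m v), ((e v).symm i : H) ∈ N ∧ vtx ((e v).symm i : H) = v := by
      intro i
      exact Finset.mem_filter.1 ((e v).symm i).2
    have hg' : ∀ h (hh : h ∈ N.filter fun h => vtx h = v), g h = (e v ⟨h, hh⟩ : ℕ) / p := by
      intro h hh
      obtain ⟨h1, rfl⟩ := Finset.mem_filter.1 hh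
      exact dif_pos hh
    refine Finset.card_bij (fun i _ => ((e v).symm i : H)) ?_ ?_ ?_
    · intro i hi
      rw [Finset.mem_filter] at hi ⊢
      refine ⟨(hg i).1, ?_⟩
      rw [Prod.mk.injEq]
      refine ⟨(hg i).2, ?_⟩
      rw [hg' _ ((e v).symm i).2]
      simpa using hi.2
    · intro i _ j _ hij
      exact (e v).symm.injective (Subtype.ext hij)
    · intro h hh
      rw [Finset.mem_filter, Prod.mk.injEq] at hh
      have hmem : h ∈ N.filter fun h => vtx h = v := Finset.mem_filter.2 ⟨hh.1, hh.2.1⟩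
      refine ⟨e v ⟨h, hmem⟩, ?_, by simp⟩
      rw [Finset.mem_filter]
      exact ⟨Finset.mem_univ _, by rw [← hg' h hmem]; exact hh.2.2⟩
  rw [this]
  exact card_fin_div_eq p (m v) n hp

open Classical in
theorem hasNonemptyKDivisibleSubgraph_of_darts {V : Type*} [Fintype V] (G : SimpleGraph V) (k : ℕ)
    (M : Finset G.Dart) (hM : M.Nonempty) (hsymm : ∀ d ∈ M, d.symm ∈ M)
    (hdvd : ∀ v, k ∣ (M.filter fun d => d.fst = v).card) :
    HasNonemptyKDivisibleSubgraph k G := by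
  let S : G.Subgraph :=
    -- Isolated vertices are harmless, having degree 0.
    { verts := Set.univ
      Adj := fun u v => ∃ h : G.Adj u v, (⟨(u, v), h⟩ : G.Dart) ∈ M
      adj_sub := fun h => h.1
      edge_vert := fun _ => Set.mem_univ _
      symm := ⟨fun u v h => ⟨h.1.symm, hsymm _ h.2⟩⟩ }
  refine ⟨S, ?_, ?_⟩
  · obtain ⟨d, hd⟩ := hM
    exact ⟨s(d.fst, d.snd), (SimpleGraph.Subgraph.mem_edgeSet).2 ⟨d.adj, hd⟩⟩
  · rintro ⟨u, hu⟩
    rw [Nat.modEq_zero_iff_dvd]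
    convert hdvd u using 1
    rw [← SimpleGraph.card_neighborFinset_eq_degree]
    symm
    refine Finset.card_bij (fun d _ => ⟨d.snd, Set.mem_univ _⟩) ?_ ?_ ?_
    · rintro ⟨⟨a, b⟩, hab⟩ hd
      obtain ⟨h1, h2⟩ := Finset.mem_filter.1 hd
      dsimp only at h2
      subst h2
      rw [SimpleGraph.mem_neighborFinset, SimpleGraph.Subgraph.coe_adj]
      exact ⟨hab, h1⟩
    · rintro ⟨⟨a, b⟩, hab⟩ hd ⟨⟨a', b'⟩, hab'⟩ hd' heq
      have h1 := (Finset.mem_filter.1 hd).2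
      have h2 := (Finset.mem_filter.1 hd').2
      have h3 := congrArg Subtype.val heq
      dsimp only at h1 h2 h3
      subst h1 h2 h3
      rfl
    · rintro ⟨b, hb⟩ hadj
      rw [SimpleGraph.mem_neighborFinset, SimpleGraph.Subgraph.coe_adj] at hadj
      obtain ⟨h1, h2⟩ := hadj
      exact ⟨⟨(u, b), h1⟩, Finset.mem_filter.2 ⟨h2, rfl⟩, rfl⟩

open Classical in
theorem hasNonemptyKDivisibleSubgraph_of_card_edges {V : Type*} [Fintype V] (G : SimpleGraph V)
    [Fintype G.edgeSet] (k : ℕ) (hk0 : 0 < k) (p : ℕ) (hp : p.Prime) (hpodd : Odd p)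
    (hk : (Even k ∧ 3 * k ≤ 2 * p) ∨ (Odd k ∧ k ≤ p))
    (hcard : (p - 1) * Fintype.card V < G.edgeFinset.card) :
    HasNonemptyKDivisibleSubgraph k G := by
  rw [SimpleGraph.edgeFinset_card] at hcard
  obtain ⟨S, hS, hSp⟩ := exists_nonempty_dvd_card p hp
    (fun (v : V) (e : G.edgeSet) => v ∈ (e : Sym2 V)) hcard
  let edge : G.Dart → G.edgeSet := fun d => ⟨d.edge, d.edge_mem⟩
  let N : Finset G.Dart := Finset.univ.filter fun d => edge d ∈ S
  have hNcard : ∀ v, p ∣ (N.filter fun d => d.fst = v).card := by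
    intro v
    convert hSp v using 1
    refine Finset.card_bij (fun d _ => edge d) ?_ ?_ ?_
    · intro d hd
      obtain ⟨h1, rfl⟩ := Finset.mem_filter.1 hd
      rw [Finset.mem_filter]
      exact ⟨(Finset.mem_filter.1 h1).2, Sym2.mem_mk_left _ _⟩
    · intro d hd d' hd' heq
      have h1 := (Finset.mem_filter.1 hd).2
      have h2 := (Finset.mem_filter.1 hd').2
      rcases (SimpleGraph.dart_edge_eq_iff d d').1 (congrArg Subtype.val heq) with h | h
      · exact h
      · exfalso
        rw [h] at h1
        exact d'.adj.ne (h2.trans h1.symm)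
    · rintro ⟨e, he⟩ heS
      rw [Finset.mem_filter] at heS
      obtain ⟨h1, h2⟩ := heS
      obtain ⟨b, rfl⟩ := Sym2.mem_iff_exists.1 h2
      exact ⟨⟨(v, b), he⟩,
        Finset.mem_filter.2 ⟨Finset.mem_filter.2 ⟨Finset.mem_univ _, h1⟩, rfl⟩, rfl⟩
  have hN : N.Nonempty := by
    obtain ⟨⟨e, he⟩, heS⟩ := hS
    induction e using Sym2.ind with
    | h a b => exact ⟨⟨(a, b), he⟩, Finset.mem_filter.2 ⟨Finset.mem_univ _, heS⟩⟩
  have hNσ : ∀ d ∈ N, d.symm ∈ N := by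
    intro d hd
    have : edge d.symm = edge d := Subtype.ext (SimpleGraph.Dart.edge_symm d)
    simpa [N, this] using hd
  obtain ⟨g, hg⟩ := exists_refinement_of_dvd (fun d : G.Dart => d.fst) p hp.pos N hNcard
  obtain ⟨M, -, hM, hMσ, hMk⟩ := exists_regular_part (fun d : G.Dart => (d.fst, g d))
    SimpleGraph.Dart.symm SimpleGraph.Dart.symm_symm SimpleGraph.Dart.symm_ne k hk0 p hpodd hk N hN
    hNσ hg
  refine hasNonemptyKDivisibleSubgraph_of_darts G k M hM hMσ fun v => ?_
  rw [Finset.card_eq_sum_card_image g]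
  refine Finset.dvd_sum fun n _ => ?_
  have := hMk (v, n)
  simp only [Prod.mk.injEq] at this
  rw [Finset.filter_filter]
  rcases this with h | h
  · rw [h]; exact dvd_zero k
  · rw [h]

theorem mainTheorem3 {V : Type*} [Fintype V] (G : SimpleGraph V) [Fintype G.edgeSet]
    (k : ℕ) (hk : 2 ≤ k) (hG : ¬ HasNonemptyKDivisibleSubgraph k G) :
    (G.edgeFinset.card : ℤ) ≤
        ((leastPrimeGE (3 * (k : ℝ) / 2) : ℤ) - 1) * (Fintype.card V : ℤ) ∧
      (Odd k →
        (G.edgeFinset.card : ℤ) ≤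
          ((leastPrimeGE (k : ℝ) : ℤ) - 1) * (Fintype.card V : ℤ)) := by
  have key : ∀ p : ℕ, p.Prime → p ≠ 2 → ((Even k ∧ 3 * k ≤ 2 * p) ∨ (Odd k ∧ k ≤ p)) →
      (G.edgeFinset.card : ℤ) ≤ ((p : ℤ) - 1) * (Fintype.card V : ℤ) := by
    intro p hp hp2 hkp
    by_contra hcon
    apply hG
    refine hasNonemptyKDivisibleSubgraph_of_card_edges G k (by omega) p hp
      (hp.odd_of_ne_two hp2) hkp ?_
    rw [not_le] at hcon
    have h1 : ((p - 1 : ℕ) : ℤ) = (p : ℤ) - 1 := by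
      rw [Nat.cast_sub hp.one_le, Nat.cast_one]
    rw [← h1] at hcon
    exact_mod_cast hcon
  constructor
  · obtain ⟨hp, hle⟩ := leastPrimeGE_spec (3 * (k : ℝ) / 2)
    have h3 : 3 * k ≤ 2 * leastPrimeGE (3 * (k : ℝ) / 2) := by
      have : (3 * k : ℝ) ≤ 2 * (leastPrimeGE (3 * (k : ℝ) / 2) : ℝ) := by linarith
      exact_mod_cast this
    -- Here `2p ≥ 3k ≥ 6` excludes `p = 2`.
    refine key _ hp (by omega) ?_
    rcases Nat.even_or_odd k with he | ho
    · exact Or.inl ⟨he, h3⟩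
    · exact Or.inr ⟨ho, by omega⟩
  · intro ho
    obtain ⟨hp, hle⟩ := leastPrimeGE_spec (k : ℝ)
    have h1 : k ≤ leastPrimeGE (k : ℝ) := by exact_mod_cast hle
    refine key _ hp ?_ (Or.inr ⟨ho, h1⟩)
    rcases ho with ⟨m, hm⟩
    omega
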